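/- Let $n\ge 1$ and let $\gamma=-\frac1{n-1}$, read as $\gamma=-\infty$ when $n=1$. Let $\phi:\mathbb R^n\to\mathbb R_+=[0,\infty)$ be a measurable function that is $\gamma$-concave, i.e. $$\phi((1-\lambda)x+\lambda y)\ \ge\ \big((1-\lambda)\phi(x)^{\gamma}+\lambda\phi(y)^{\gamma}\big)^{1/\gamma}$$ for all $\lambda\in[0,1]$ and all $x,y\in\mathbb R^n$ with $\phi(x)\phi(y)>0$, where for $\gamma=-\infty$ the right-hand side means $\min(\phi(x),\phi(y))$. Let $\mu$ be the measure on $\mathbb R^n$ with density $\phi$ with respect to Lebesgue measure. For a Borel set $A\subset\mathbb R^n$ and a hyperplane $H\subset\mathbb R^n$ put $\mu_{n-1}(A\cap H)=\int_{A\cap H}\phi(x)\,\mathrm dx\in[0,+\infty]$, the integral being with respect to the $(n-1)$-dimensional Lebesgue measure on $H$ (for $n=1$, the unit mass at the point $H$). Let $A,B\subset\mathbb R^n$ be Borel sets. If there is a unit vector $u\in\mathbb R^n$ such that $$\sup_{t\in\mathbb R}\mu_{n-1}\big(A\cap(u^\perp+tu)\big)=\sup_{t\in\mathbb R}\mu_{n-1}\big(B\cap(u^\perp+tu)\big)$$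 (as elements of $[0,+\infty]$), then for every $\lambda\in[0,1]$ $$\mu\big((1-\lambda)A+\lambda B\big)\ \ge\ (1-\lambda)\,\mu(A)+\lambda\,\mu(B),$$ where $(1-\lambda)A+\lambda B=\{(1-\lambda)a+\lambda b:\ a\in A,\ b\in B\}$ and $0\cdot\infty=0$. -/

import Mathlib

open MeasureTheory Set
open scoped NNReal ENNReal Pointwise

noncomputable section

/-- The weighted power mean of order `γ ∈ [-∞, +∞]` of the positive numbers `a`, `b`, with weights
`1 - lam` and `lam`. The limit cases are the minimum (`γ = -∞`), the maximum (`γ = +∞`) and the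
geometric mean (`γ = 0`). -/
def gammaMean (γ : EReal) (lam a b : ℝ) : ℝ :=
  if γ = ⊥ then min a b
  else if γ = ⊤ then max a b
  else if γ = 0 then a ^ (1 - lam) * b ^ lam
  else ((1 - lam) * a ^ γ.toReal + lam * b ^ γ.toReal) ^ (1 / γ.toReal)

/-- A function `f : ℝⁿ → ℝ₊` is `γ`-concave if `f ((1 - lam) x + lam y)` is at least the mean of
order `γ` of `f x` and `f y`, for all `x`, `y` with `f x * f y > 0` and all `lam ∈ [0, 1]`. -/
def IsGammaConcave {n : ℕ} (γ : EReal) (f : EuclideanSpace ℝ (Fin n) → ℝ≥0) : Prop :=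
  ∀ x y : EuclideanSpace ℝ (Fin n), 0 < f x * f y → ∀ lam ∈ Icc (0 : ℝ) 1,
    gammaMean γ lam (f x) (f y) ≤ f ((1 - lam) • x + lam • y)

/-- The exponent `-1 / (n - 1)`, for `n ≥ 1`, read as `-∞` when `n = 1`. -/
def critExponent (n : ℕ) : EReal :=
  if n = 1 then ⊥ else ((-(1 / ((n : ℝ) - 1)) : ℝ) : EReal)

/-- The `(n - 1)`-dimensional measure with density `φ` of the section of `A` by the hyperplane
`u^⊥ + t u`, that is, the integral of `φ` over `A ∩ (u^⊥ + t u)`. The hyperplane is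
parametrized isometrically by `y ↦ y + t u`, where `y` runs through the Euclidean space `u^⊥` with
its Lebesgue measure (for `n = 1`, this is the unit mass at `0`). -/
def sectionMeasure {n : ℕ} (φ : EuclideanSpace ℝ (Fin n) → ℝ≥0)
    (A : Set (EuclideanSpace ℝ (Fin n))) (u : EuclideanSpace ℝ (Fin n)) (t : ℝ) : ℝ≥0∞ :=
  ∫⁻ y in {y : (ℝ ∙ u)ᗮ | (y : EuclideanSpace ℝ (Fin n)) + t • u ∈ A},
    (φ ((y : EuclideanSpace ℝ (Fin n)) + t • u) : ℝ≥0∞)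

end

/-! Slice by the hyperplanes orthogonal to `u`. In dimension `n - 1` the exponent `-1 / (n - 1)` is
exactly the one that the Borell-Brascamp-Lieb inequality (`recipMean_lintegral_le`) turns into `-∞`:
the section of the Minkowski sum at height `p s + q t` has measure at least the minimum of those of
`A` at `s` and `B` at `t`. So the superlevel sets of the section functions of `A` and `B`, at a
common level, combine into that of the sum. Equal suprema make the first two nonempty for the same
levels, so Brunn-Minkowski on the line applies at each level, and integrating over levels gives the
linear bound (`lintegral_add_le_of_min_le_of_iSup_eq`). The Borell-Brascamp-Lieb inequality is
proved by induction on dimension. Its one-dimensional step uses the same equal-supremum inequality,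
after dividing the functions by their suprema, and a Hölder inequality for means
(`recipMean.le_mul_add`). -/

/-! ### Brunn-Minkowski on the line and functions with equal suprema -/

theorem volume_add_le_volume_add_of_isCompact {K L : Set ℝ} (hK : IsCompact K) (hL : IsCompact L)
    (hK' : K.Nonempty) (hL' : L.Nonempty) : volume K + volume L ≤ volume (K + L) := by
  obtain ⟨a, haK, ha⟩ := hK.exists_isGreatest hK'
  obtain ⟨b, hbL, hb⟩ := hL.exists_isLeast hL'
  have h1 : volume (K + {b}) = volume K := by simp
  have h2 : volume ({a} + L) = volume L := by simp
  have h4 := measure_union_add_inter (μ := (volume : Measure ℝ)) (K + {b} : Set ℝ)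
    ((isCompact_singleton (x := a)).add hL).isClosed.measurableSet
  -- With `a = max K` and `b = min L`, the two translates lie on either side of `a + b`, so they
  -- meet in at most that point.
  have h3 : volume ((K + {b}) ∩ ({a} + L)) = 0 := by
    refine measure_mono_null (t := {a + b}) ?_ (by simp)
    rintro x ⟨⟨k, hk, _, rfl, rfl⟩, ⟨_, rfl, l, hl, h⟩⟩
    have := ha hk
    have := hb hl
    simp only [mem_singleton_iff] at *
    linarith
  rw [← h1, ← h2, ← h4, h3, add_zero]
  refine measure_mono (union_subset ?_ ?_)
  · exact add_subset_add_left (by simpa using hbL)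
  · exact add_subset_add_right (by simpa using haK)

/-- The Brunn-Minkowski inequality on the real line. -/
theorem volume_add_le_volume_add {A B : Set ℝ} (hA : MeasurableSet A) (hB : MeasurableSet B)
    (hA' : A.Nonempty) (hB' : B.Nonempty) : volume A + volume B ≤ volume (A + B) := by
  obtain ⟨a, ha⟩ := hA'
  obtain ⟨b, hb⟩ := hB'
  rw [hA.measure_eq_iSup_isCompact, hB.measure_eq_iSup_isCompact]
  simp only [iSup_and']
  refine ENNReal.biSup_add_biSup_le' ⟨∅, by simp⟩ ⟨∅, by simp⟩ ?_
  rintro K ⟨hKA, hK⟩ L ⟨hLB, hL⟩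
  -- The approximating compact sets may be empty, so a point of each set is adjoined.
  calc volume K + volume L ≤ volume (insert a K) + volume (insert b L) := by
        gcongr <;> exact subset_insert _ _
    _ ≤ volume (insert a K + insert b L) :=
        volume_add_le_volume_add_of_isCompact (hK.insert a) (hL.insert b) (insert_nonempty _ _)
          (insert_nonempty _ _)
    _ ≤ _ := measure_mono (add_subset_add (insert_subset ha hKA) (insert_subset hb hLB))

theorem volume_smul_add_smul_le {A B : Set ℝ} (hA : MeasurableSet A) (hB : MeasurableSet B)
    (hA' : A.Nonempty) (hB' : B.Nonempty) {p q : ℝ} (hp : 0 < p) (hq : 0 < q) :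
    ENNReal.ofReal p * volume A + ENNReal.ofReal q * volume B ≤ volume (p • A + q • B) := by
  have h := volume_add_le_volume_add (hA.const_smul_of_ne_zero hp.ne')
    (hB.const_smul_of_ne_zero hq.ne') (hA'.smul_set (a := p)) (hB'.smul_set (a := q))
  simpa [Measure.addHaar_smul, abs_of_pos, hp, hq] using h

/-- Layer cake by Tonelli: `f x` is the length of the set of `t > 0` below it, also when `f x = ∞`.
-/
theorem lintegral_eq_lintegral_volume_superlevel {α : Type*} [MeasurableSpace α] (μ : Measure α)
    [SFinite μ] {f : α → ℝ≥0∞} (hf : Measurable f) :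
    ∫⁻ x, f x ∂μ = ∫⁻ t in Ioi (0 : ℝ), μ {x | ENNReal.ofReal t < f x} := by
  have hvol : ∀ c : ℝ≥0∞, ∫⁻ t in Ioi (0 : ℝ), {t | ENNReal.ofReal t < c}.indicator 1 t = c := by
    intro c
    rw [lintegral_indicator_one (measurableSet_lt (by fun_prop) (by fun_prop)),
      Measure.restrict_apply (measurableSet_lt (by fun_prop) (by fun_prop))]
    induction c with
    | top => simp
    | coe c =>
      have : {t : ℝ | ENNReal.ofReal t < c} ∩ Ioi 0 = Ioo 0 (c : ℝ) := by
        ext t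
        simp only [mem_inter_iff, mem_ofPred_eq, mem_Ioi, mem_Ioo, and_comm (b := 0 < t)]
        refine and_congr_right fun ht => ?_
        rw [← ENNReal.ofReal_coe_nnreal, ENNReal.ofReal_lt_ofReal_iff_of_nonneg ht.le]
      rw [this]
      simp
  have hm : MeasurableSet {z : α × ℝ | ENNReal.ofReal z.2 < f z.1} :=
    measurableSet_lt (by fun_prop) (by fun_prop)
  calc ∫⁻ x, f x ∂μ
      = ∫⁻ x, (∫⁻ t in Ioi (0 : ℝ),
          {z : α × ℝ | ENNReal.ofReal z.2 < f z.1}.indicator 1 (x, t)) ∂μ := by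
        refine lintegral_congr fun x => ?_
        conv_lhs => rw [← hvol (f x)]
        rfl
    _ = ∫⁻ t in Ioi (0 : ℝ), ∫⁻ x,
          {z : α × ℝ | ENNReal.ofReal z.2 < f z.1}.indicator 1 (x, t) ∂μ :=
        lintegral_lintegral_swap ((measurable_one.indicator hm).aemeasurable)
    _ = _ := by
        refine lintegral_congr fun t => ?_
        rw [← lintegral_indicator_one (measurableSet_lt (by fun_prop) (by fun_prop))]
        rfl

/-- A function inequality on the real line for two functions with the same supremum. -/
theorem lintegral_add_le_of_min_le_of_iSup_eq {f g h : ℝ → ℝ≥0∞} (hf : Measurable f)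
    (hg : Measurable g) (hh : Measurable h) {p q : ℝ} (hp : 0 < p) (hq : 0 < q)
    (hsup : (⨆ x, f x) = ⨆ x, g x) (hfgh : ∀ x y, min (f x) (g y) ≤ h (p * x + q * y)) :
    ENNReal.ofReal p * (∫⁻ x, f x) + ENNReal.ofReal q * (∫⁻ x, g x) ≤ ∫⁻ x, h x := by
  have hmeas : ∀ {f : ℝ → ℝ≥0∞}, Measurable f →
      Measurable fun t : ℝ => volume {x | ENNReal.ofReal t < f x} := fun {f} hf =>
    Antitone.measurable fun s t hst => measure_mono fun x (hx : ENNReal.ofReal t < f x) =>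
      (ENNReal.ofReal_le_ofReal hst).trans_lt hx
  rw [lintegral_eq_lintegral_volume_superlevel volume hf,
    lintegral_eq_lintegral_volume_superlevel volume hg,
    lintegral_eq_lintegral_volume_superlevel volume hh, ← lintegral_const_mul _ (hmeas hf),
    ← lintegral_const_mul _ (hmeas hg), ← lintegral_add_left ((hmeas hf).const_mul _)]
  refine lintegral_mono fun t => ?_
  have hsub : p • {x | ENNReal.ofReal t < f x} + q • {x | ENNReal.ofReal t < g x} ⊆
      {x | ENNReal.ofReal t < h x} := by
    rintro _ ⟨_, ⟨x, hx, rfl⟩, _, ⟨y, hy, rfl⟩, rfl⟩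
    exact (lt_min hx hy).trans_le (hfgh x y)
  -- Below the common supremum both superlevel sets are nonempty; from it on both are empty. The bad
  -- case, exactly one of them empty, never occurs.
  rcases lt_or_ge (ENNReal.ofReal t) (⨆ x, f x) with ht | ht
  · have ht' := ht
    rw [hsup] at ht'
    exact (volume_smul_add_smul_le (measurableSet_lt (by fun_prop) hf)
      (measurableSet_lt (by fun_prop) hg) (lt_iSup_iff.1 ht) (lt_iSup_iff.1 ht') hp hq).trans
      (measure_mono hsub)
  · have h1 : {x | ENNReal.ofReal t < f x} = ∅ :=
      eq_empty_of_forall_notMem fun x hx => (hx.trans_le (le_iSup f x)).not_ge ht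
    have h2 : {x | ENNReal.ofReal t < g x} = ∅ :=
      eq_empty_of_forall_notMem fun x hx => (hx.trans_le (le_iSup g x)).not_ge (hsup ▸ ht)
    simp [h1, h2]

/-- Cavalieri's principle: slicing by the hyperplanes orthogonal to a unit vector. -/
theorem measurePreserving_add_smul {E : Type*} [NormedAddCommGroup E] [InnerProductSpace ℝ E]
    [FiniteDimensional ℝ E] [MeasurableSpace E] [BorelSpace E] {u : E} (hu : ‖u‖ = 1) :
    MeasurePreserving (fun z : ℝ × (ℝ ∙ u)ᗮ => (z.2 : E) + z.1 • u) := by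
  have h1 : MeasurePreserving (LinearIsometryEquiv.toSpanUnitSingleton (𝕜 := ℝ) u hu) :=
    LinearIsometryEquiv.measurePreserving _
  have h2 := h1.prod (MeasurePreserving.id (volume : Measure (ℝ ∙ u)ᗮ))
  have h3 := ((ℝ ∙ u).orthogonalDecomposition.symm.measurePreserving.comp
    (WithLp.volume_preserving_toLp (ℝ ∙ u) (ℝ ∙ u)ᗮ)).comp h2
  convert! h3 using 1
  ext z
  simp [add_comm]

/-! ### Power means of order `-1 / k` on `[0, ∞]` -/

/-- The mean `(p a ^ (-1 / k) + q b ^ (-1 / k)) ^ (-k)` of order `-1 / k`, read as the minimum when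
`k = 0`. -/
noncomputable def recipMean (k : ℕ) (p q : ℝ≥0) (a b : ℝ≥0∞) : ℝ≥0∞ :=
  if k = 0 then min a b else (p * a ^ (-(1 / k : ℝ)) + q * b ^ (-(1 / k : ℝ))) ^ (-(k : ℝ))

namespace recipMean

variable {k : ℕ} {p q : ℝ≥0} {a b c d : ℝ≥0∞}

theorem of_zero : recipMean 0 p q a b = min a b := by simp [recipMean]

theorem of_ne_zero (hk : k ≠ 0) : recipMean k p q a b =
    (p * a ^ (-(1 / k : ℝ)) + q * b ^ (-(1 / k : ℝ))) ^ (-(k : ℝ)) := by simp [recipMean, hk]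

theorem mono (hac : a ≤ c) (hbd : b ≤ d) : recipMean k p q a b ≤ recipMean k p q c d := by
  rcases eq_or_ne k 0 with rfl | hk
  · simpa only [of_zero] using min_le_min hac hbd
  · simp only [of_ne_zero hk, ENNReal.rpow_neg]
    gcongr

theorem zero_left (hp : p ≠ 0) : recipMean k p q 0 b = 0 := by
  rcases eq_or_ne k 0 with rfl | hk
  · simp [of_zero]
  · have : 0 < k := Nat.pos_of_ne_zero hk
    rw [of_ne_zero hk, ENNReal.zero_rpow_of_neg (by simpa using this),
      ENNReal.mul_top (by simpa using hp), top_add, ENNReal.top_rpow_of_neg (by simpa using this)]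

theorem zero_right (hq : q ≠ 0) : recipMean k p q a 0 = 0 := by
  rcases eq_or_ne k 0 with rfl | hk
  · simp [of_zero]
  · have : 0 < k := Nat.pos_of_ne_zero hk
    rw [of_ne_zero hk, ENNReal.zero_rpow_of_neg (by simpa using this),
      ENNReal.mul_top (by simpa using hq), add_top, ENNReal.top_rpow_of_neg (by simpa using this)]

theorem continuous : Continuous fun z : ℝ≥0∞ × ℝ≥0∞ => recipMean k p q z.1 z.2 := by
  rcases eq_or_ne k 0 with rfl | hk
  · simp only [of_zero]
    fun_prop
  · simp only [of_ne_zero hk]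
    exact ENNReal.continuous_rpow_const.comp
      (((ENNReal.continuous_const_mul (by simp)).comp
          (ENNReal.continuous_rpow_const.comp continuous_fst)).add
        ((ENNReal.continuous_const_mul (by simp)).comp
          (ENNReal.continuous_rpow_const.comp continuous_snd)))

/-- The substitution `a = u ^ (-k)` makes the mean linear inside, so that later identities involve
natural powers only. -/
theorem inv_pow (hk : k ≠ 0) (hp : p ≠ 0) {u v : ℝ≥0} (hu : u ≠ 0) (hv : v ≠ 0) :
    recipMean k p q ((u ^ k)⁻¹ : ℝ≥0) ((v ^ k)⁻¹ : ℝ≥0) = (((p * u + q * v) ^ k)⁻¹ : ℝ≥0) := by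
  have key : ∀ {u : ℝ≥0}, u ≠ 0 → (((u ^ k)⁻¹ : ℝ≥0) : ℝ≥0∞) ^ (-(1 / k : ℝ)) = u := by
    intro u hu
    rw [← ENNReal.coe_rpow_of_ne_zero (by positivity), NNReal.rpow_neg, NNReal.inv_rpow, inv_inv,
      one_div, NNReal.pow_rpow_inv_natCast _ hk]
  rw [of_ne_zero hk, key hu, key hv]
  have h : p * u + q * v ≠ 0 := by positivity
  rw [← ENNReal.coe_mul, ← ENNReal.coe_mul, ← ENNReal.coe_add, ← ENNReal.coe_rpow_of_ne_zero h,
    NNReal.rpow_neg, NNReal.rpow_natCast]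

theorem exists_eq_inv_pow (hk : k ≠ 0) (ha : a ≠ 0) (ha' : a ≠ ∞) :
    ∃ u : ℝ≥0, u ≠ 0 ∧ a = ((u ^ k)⁻¹ : ℝ≥0) := by
  lift a to ℝ≥0 using ha'
  rw [ENNReal.coe_ne_zero] at ha
  refine ⟨(a⁻¹) ^ (k⁻¹ : ℝ), by positivity, ?_⟩
  rw [NNReal.rpow_inv_natCast_pow _ hk, inv_inv]

theorem ne_zero_ne_top (hp : p ≠ 0) (ha : a ≠ 0) (ha' : a ≠ ∞) (hb : b ≠ 0) (hb' : b ≠ ∞) :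
    recipMean k p q a b ≠ 0 ∧ recipMean k p q a b ≠ ∞ := by
  rcases eq_or_ne k 0 with rfl | hk
  · rw [of_zero]
    rcases min_choice a b with h | h <;> simp [*]
  · obtain ⟨u, hu, rfl⟩ := exists_eq_inv_pow hk ha ha'
    obtain ⟨v, hv, rfl⟩ := exists_eq_inv_pow hk hb hb'
    rw [inv_pow hk hp hu hv]
    exact ⟨by rw [ENNReal.coe_ne_zero]; positivity, ENNReal.coe_ne_top⟩

theorem mul_mul (hk : k ≠ 0) (hp : p ≠ 0) (ha : a ≠ 0) (ha' : a ≠ ∞) (hb : b ≠ 0) (hb' : b ≠ ∞)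
    {r : ℝ≥0∞} (hr : r ≠ 0) (hr' : r ≠ ∞) :
    recipMean k p q (r * a) (r * b) = r * recipMean k p q a b := by
  obtain ⟨u, hu, rfl⟩ := exists_eq_inv_pow hk ha ha'
  obtain ⟨v, hv, rfl⟩ := exists_eq_inv_pow hk hb hb'
  obtain ⟨s, hs, rfl⟩ := exists_eq_inv_pow hk hr hr'
  simp only [← ENNReal.coe_mul, ← mul_inv, ← mul_pow]
  rw [inv_pow hk hp (mul_ne_zero hs hu) (mul_ne_zero hs hv), inv_pow hk hp hu hv,
    ← ENNReal.coe_mul, ← mul_inv, ← mul_pow]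
  congr 4
  ring

/-- Hölder's inequality for means of orders `-1 / k`, `-1 / (k + 1)` and `1`, whose reciprocals
satisfy `-k = -(k + 1) + 1`. For `k ≠ 0` and finite positive arguments it amounts to convexity of `t
^ (k + 1)`. -/
theorem le_mul_add {F G : ℝ≥0∞} (hp : p ≠ 0) (hq : q ≠ 0) (ha : a ≠ 0)
    (ha' : a ≠ ∞) (hb : b ≠ 0) (hb' : b ≠ ∞) :
    recipMean k p q F G ≤ recipMean (k + 1) p q a b * (p * (F / a) + q * (G / b)) := by
  have hM := ne_zero_ne_top (k := k + 1) (q := q) hp ha ha' hb hb'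
  rcases eq_or_ne F 0 with rfl | hF
  · simp [zero_left hp]
  rcases eq_or_ne G 0 with rfl | hG
  · simp [zero_right hq]
  rcases eq_or_ne F ∞ with rfl | hF'
  · rw [ENNReal.top_div_of_ne_top ha', ENNReal.mul_top (by simpa), top_add, ENNReal.mul_top hM.1]
    exact le_top
  rcases eq_or_ne G ∞ with rfl | hG'
  · rw [ENNReal.top_div_of_ne_top hb', ENNReal.mul_top (by simpa), add_top, ENNReal.mul_top hM.1]
    exact le_top
  obtain ⟨x, hx, rfl⟩ := exists_eq_inv_pow (k := k + 1) k.succ_ne_zero ha ha'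
  obtain ⟨y, hy, rfl⟩ := exists_eq_inv_pow (k := k + 1) k.succ_ne_zero hb hb'
  rw [inv_pow k.succ_ne_zero hp hx hy]
  rcases eq_or_ne k 0 with rfl | hk
  · lift F to ℝ≥0 using hF'
    lift G to ℝ≥0 using hG'
    rw [of_zero]
    simp only [zero_add, pow_one]
    rw [← ENNReal.coe_min, ← ENNReal.coe_div (inv_ne_zero hx), ← ENNReal.coe_div (inv_ne_zero hy)]
    norm_cast
    have hX : 0 < p * x + q * y := by positivity
    simp only [div_inv_eq_mul]
    rw [inv_mul_eq_div, le_div_iff₀ hX, mul_add]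
    calc _ = p * (min F G * x) + q * (min F G * y) := by ring
      _ ≤ _ := by gcongr <;> simp
  · obtain ⟨u, hu, rfl⟩ := exists_eq_inv_pow hk hF hF'
    obtain ⟨v, hv, rfl⟩ := exists_eq_inv_pow hk hG hG'
    rw [inv_pow hk hp hu hv]
    simp only [← ENNReal.coe_div (inv_ne_zero (pow_ne_zero (k + 1) hx)),
      ← ENNReal.coe_div (inv_ne_zero (pow_ne_zero (k + 1) hy))]
    norm_cast
    have hX : p * x + q * y ≠ 0 := by positivity
    have hU : p * u + q * v ≠ 0 := by positivity
    -- The weights are chosen so that `x / u` and `y / v` average to `(p x + q y) / (p u + q v)`.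
    have h := NNReal.pow_arith_mean_le_arith_mean_pow Finset.univ
      ![p * u / (p * u + q * v), q * v / (p * u + q * v)] ![x / u, y / v]
      (by simp [← add_div, div_self hU]) (k + 1)
    simp only [Fin.sum_univ_two, Matrix.cons_val_zero, Matrix.cons_val_one] at h
    have e1 : p * u / (p * u + q * v) * (x / u) + q * v / (p * u + q * v) * (y / v)
        = (p * x + q * y) / (p * u + q * v) := by field_simp
    rw [e1] at h
    rw [inv_mul_eq_div, le_div_iff₀ (by positivity)]
    calc ((p * u + q * v) ^ k)⁻¹ * (p * x + q * y) ^ (k + 1)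
        = (p * u + q * v) * ((p * x + q * y) / (p * u + q * v)) ^ (k + 1) := by
          rw [div_pow, pow_succ (p * u + q * v)]
          field_simp
      _ ≤ (p * u + q * v) * (p * u / (p * u + q * v) * (x / u) ^ (k + 1) +
          q * v / (p * u + q * v) * (y / v) ^ (k + 1)) := by gcongr
      _ = _ := by
          rw [div_pow, div_pow, pow_succ u, pow_succ v]
          field_simp

end recipMean

/-! ### The Borell-Brascamp-Lieb inequality -/

/-- The Borell-Brascamp-Lieb inequality on the real line, for bounded functions. -/
theorem recipMean_lintegral_le_of_bounded {k : ℕ} {p q : ℝ≥0} (hp : p ≠ 0) (hq : q ≠ 0)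
    {f g h : ℝ → ℝ≥0∞} (hf : Measurable f) (hg : Measurable g) (hh : Measurable h)
    (hf' : (⨆ x, f x) ≠ ∞) (hg' : (⨆ x, g x) ≠ ∞)
    (hfgh : ∀ x y, recipMean (k + 1) p q (f x) (g y) ≤ h (p * x + q * y)) :
    recipMean k p q (∫⁻ x, f x) (∫⁻ x, g x) ≤ ∫⁻ x, h x := by
  rcases eq_or_ne (⨆ x, f x) 0 with ha | ha
  · have : ∀ x, f x = 0 := by simpa using ha
    simp [this, recipMean.zero_left hp]
  rcases eq_or_ne (⨆ x, g x) 0 with hb | hb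
  · have : ∀ x, g x = 0 := by simpa using hb
    simp [this, recipMean.zero_right hq]
  set a := ⨆ x, f x with ha_def
  set b := ⨆ x, g x with hb_def
  obtain ⟨hc, hc'⟩ := recipMean.ne_zero_ne_top (k := k + 1) (q := q) hp ha hf' hb hg'
  set c := recipMean (k + 1) p q a b with hc_def
  -- After normalization `f / a` and `g / b` both have supremum `1`. If both are at least `r` at `x`
  -- and `y`, homogeneity of the mean gives `h ≥ r c` at `p x + q y`.
  have key := lintegral_add_le_of_min_le_of_iSup_eq (hf.div_const a) (hg.div_const b)
    (hh.div_const c) (p := p) (q := q) (by positivity) (by positivity)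
    (by rw [← ENNReal.iSup_div, ← ENNReal.iSup_div, ENNReal.div_self ha hf',
      ENNReal.div_self hb hg']) (by
    intro x y
    set r := min (f x / a) (g y / b) with hr_def
    rcases eq_or_ne r 0 with hr | hr
    · simp [hr]
    have hr' : r ≠ ∞ := by
      refine ne_top_of_le_ne_top ENNReal.one_ne_top ((min_le_left _ _).trans ?_)
      exact ENNReal.div_le_of_le_mul (by simpa using le_iSup f x)
    rw [ENNReal.le_div_iff_mul_le (Or.inl hc) (Or.inl hc'), hc_def,
      ← recipMean.mul_mul k.succ_ne_zero hp ha hf' hb hg' hr hr']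
    refine (recipMean.mono ?_ ?_).trans (hfgh x y)
    · rw [← ENNReal.le_div_iff_mul_le (Or.inl ha) (Or.inl hf')]
      exact min_le_left _ _
    · rw [← ENNReal.le_div_iff_mul_le (Or.inl hb) (Or.inl hg')]
      exact min_le_right _ _)
  simp only [div_eq_mul_inv, lintegral_mul_const _ hf, lintegral_mul_const _ hg,
    lintegral_mul_const _ hh, ENNReal.ofReal_coe_nnreal] at key
  simp only [← div_eq_mul_inv] at key
  calc _ ≤ c * (p * ((∫⁻ x, f x) / a) + q * ((∫⁻ x, g x) / b)) :=
        recipMean.le_mul_add hp hq ha hf' hb hg'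
    _ ≤ c * ((∫⁻ x, h x) / c) := by gcongr
    _ ≤ _ := ENNReal.mul_div_le

theorem tendsto_lintegral_min_natCast {α : Type*} [MeasurableSpace α] {μ : Measure α}
    {f : α → ℝ≥0∞} (hf : Measurable f) :
    Filter.Tendsto (fun N : ℕ => ∫⁻ x, min (f x) N ∂μ) Filter.atTop (nhds (∫⁻ x, f x ∂μ)) := by
  refine lintegral_tendsto_of_tendsto_of_monotone (fun N => by fun_prop)
    (.of_forall fun x m n hmn => by dsimp only; gcongr) (.of_forall fun x => ?_)
  simpa using (tendsto_const_nhds (x := f x)).min ENNReal.tendsto_nat_nhds_top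

/-- The Borell-Brascamp-Lieb inequality on the real line. -/
theorem recipMean_lintegral_le_real {k : ℕ} {p q : ℝ≥0} (hp : p ≠ 0) (hq : q ≠ 0)
    {f g h : ℝ → ℝ≥0∞} (hf : Measurable f) (hg : Measurable g) (hh : Measurable h)
    (hfgh : ∀ x y, recipMean (k + 1) p q (f x) (g y) ≤ h (p * x + q * y)) :
    recipMean k p q (∫⁻ x, f x) (∫⁻ x, g x) ≤ ∫⁻ x, h x := by
  -- Truncating `f` and `g` at `N` makes the suprema finite and keeps the hypothesis with the same
  -- `h`; continuity of the mean passes to the limit.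
  refine le_of_tendsto' ((recipMean.continuous.tendsto _).comp
    ((tendsto_lintegral_min_natCast hf).prodMk_nhds (tendsto_lintegral_min_natCast hg)))
    fun N => ?_
  refine recipMean_lintegral_le_of_bounded hp hq (by fun_prop) (by fun_prop) hh
    (ne_top_of_le_ne_top (ENNReal.natCast_ne_top N) (iSup_le fun x => min_le_right _ _))
    (ne_top_of_le_ne_top (ENNReal.natCast_ne_top N) (iSup_le fun x => min_le_right _ _))
    fun x y => ?_
  exact (recipMean.mono (min_le_left _ _) (min_le_left _ _)).trans (hfgh x y)

section Slicing

variable {E : Type*} [NormedAddCommGroup E] [InnerProductSpace ℝ E] [FiniteDimensional ℝ E]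
  [MeasurableSpace E] [BorelSpace E]

theorem lintegral_eq_lintegral_lintegral_orthogonal {u : E} (hu : ‖u‖ = 1) {f : E → ℝ≥0∞}
    (hf : Measurable f) :
    ∫⁻ x, f x = ∫⁻ t : ℝ, ∫⁻ y : (ℝ ∙ u)ᗮ, f (y + t • u) := by
  have h := measurePreserving_add_smul hu
  rw [← h.lintegral_comp hf]
  exact lintegral_prod _ (hf.comp h.measurable).aemeasurable

theorem measurable_lintegral_orthogonal (u : E) {f : E → ℝ≥0∞} (hf : Measurable f) :
    Measurable fun t : ℝ => ∫⁻ y : (ℝ ∙ u)ᗮ, f (y + t • u) := by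
  refine Measurable.lintegral_prod_right (f := fun t y => f ((y : (ℝ ∙ u)ᗮ) + t • u)) ?_
  fun_prop

end Slicing

/-- The parallelepiped of the empty orthonormal basis has volume `1`, so it is nonempty and fills
the one-point space. -/
theorem volume_univ_of_finrank_eq_zero {E : Type*} [NormedAddCommGroup E] [InnerProductSpace ℝ E]
    [FiniteDimensional ℝ E] [MeasurableSpace E] [BorelSpace E] (hE : Module.finrank ℝ E = 0) :
    volume (univ : Set E) = 1 := by
  have : Subsingleton E := Module.finrank_zero_iff.1 hE
  have h := (stdOrthonormalBasis ℝ E).volume_parallelepiped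
  have hne := nonempty_of_measure_ne_zero (h ▸ one_ne_zero)
  rwa [Subsingleton.eq_univ_of_nonempty hne] at h

/-- The Borell-Brascamp-Lieb inequality with exponent `-1 / (m + k)` in dimension `m`. -/
theorem recipMean_lintegral_le {p q : ℝ≥0} (hp : p ≠ 0) (hq : q ≠ 0) (m : ℕ) :
    ∀ {E : Type*} [NormedAddCommGroup E] [InnerProductSpace ℝ E] [FiniteDimensional ℝ E]
      [MeasurableSpace E] [BorelSpace E], Module.finrank ℝ E = m →
      ∀ (k : ℕ) {f g h : E → ℝ≥0∞}, Measurable f → Measurable g → Measurable h →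
      (∀ x y, recipMean (m + k) p q (f x) (g y) ≤ h ((p : ℝ) • x + (q : ℝ) • y)) →
      recipMean k p q (∫⁻ x, f x) (∫⁻ x, g x) ≤ ∫⁻ x, h x := by
  induction m with
  | zero =>
    intro E _ _ _ _ _ hE k f g h hf hg hh hfgh
    have : Subsingleton E := Module.finrank_zero_iff.1 hE
    have hint : ∀ f : E → ℝ≥0∞, ∫⁻ x, f x = f 0 := fun f => by
      rw [show f = fun _ => f 0 from funext fun x => congrArg f (Subsingleton.elim _ _),
        lintegral_const, volume_univ_of_finrank_eq_zero hE, mul_one]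
    simpa [hint] using hfgh 0 0
  | succ m ih =>
    intro E _ _ _ _ _ hE k f g h hf hg hh hfgh
    have : Nontrivial E := Module.nontrivial_of_finrank_pos (R := ℝ) (by omega)
    obtain ⟨u, hu⟩ := exists_norm_eq E zero_le_one
    have hu0 : u ≠ 0 := by rintro rfl; simp at hu
    have hdim : Module.finrank ℝ (ℝ ∙ u)ᗮ = m := by
      have : Fact (Module.finrank ℝ E = m + 1) := ⟨hE⟩
      exact Submodule.finrank_orthogonal_span_singleton hu0
    simp only [lintegral_eq_lintegral_lintegral_orthogonal hu, hf, hg, hh]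
    -- The sum `m + (k + 1) = (m + 1) + k` is conserved: integrating over the hyperplanes leaves
    -- order `-1 / (k + 1)`, and the remaining integral over the line leaves `-1 / k`.
    refine recipMean_lintegral_le_real hp hq (measurable_lintegral_orthogonal u hf)
      (measurable_lintegral_orthogonal u hg) (measurable_lintegral_orthogonal u hh) fun s t => ?_
    refine ih hdim (k + 1) (by fun_prop) (by fun_prop) (by fun_prop) fun x y => ?_
    rw [show m + (k + 1) = m + 1 + k by ring]
    refine (hfgh _ _).trans_eq (congrArg h ?_)
    push_cast
    module

/-! ### From `γ`-concave densities to the measure inequality -/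

theorem recipMean.coe {k : ℕ} (hk : k ≠ 0) {p q : ℝ≥0} (hp : p ≠ 0) {a b : ℝ≥0} (ha : a ≠ 0)
    (hb : b ≠ 0) : recipMean k p q a b =
      ((p * a ^ (-(1 / k : ℝ)) + q * b ^ (-(1 / k : ℝ))) ^ (-(k : ℝ)) : ℝ≥0) := by
  have ha' : a ^ (-(1 / k : ℝ)) ≠ 0 := by positivity
  rw [recipMean.of_ne_zero hk, ENNReal.coe_rpow_of_ne_zero (by positivity), ENNReal.coe_add,
    ENNReal.coe_mul, ENNReal.coe_mul, ENNReal.coe_rpow_of_ne_zero ha,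
    ENNReal.coe_rpow_of_ne_zero hb]

/-- The mean vanishes as soon as one argument does, so the restriction to points where `φ` is
positive disappears. -/
theorem IsGammaConcave.recipMean_le {m : ℕ} {φ : EuclideanSpace ℝ (Fin (m + 1)) → ℝ≥0}
    (hφ : IsGammaConcave (critExponent (m + 1)) φ) {p q : ℝ≥0} (hp : p ≠ 0) (hq : q ≠ 0)
    (hpq : p + q = 1) (x y : EuclideanSpace ℝ (Fin (m + 1))) :
    recipMean m p q (φ x) (φ y) ≤ φ ((p : ℝ) • x + (q : ℝ) • y) := by
  rcases eq_or_ne (φ x) 0 with hx | hx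
  · simp [hx, recipMean.zero_left hp]
  rcases eq_or_ne (φ y) 0 with hy | hy
  · simp [hy, recipMean.zero_right hq]
  have hpq' : 1 - (q : ℝ) = p := by
    rw [← NNReal.coe_one, ← hpq]
    simp
  have h := hφ x y (by positivity) q ⟨q.2, by linarith [p.2]⟩
  rw [hpq'] at h
  rcases eq_or_ne m 0 with rfl | hm
  · rw [recipMean.of_zero]
    simp only [gammaMean, critExponent, zero_add, if_true] at h
    exact_mod_cast h
  · rw [recipMean.coe hm hp hx hy, ENNReal.coe_le_coe, ← NNReal.coe_le_coe]
    have hm' : (m : ℝ) ≠ 0 := mod_cast hm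
    have h1 : critExponent (m + 1) = ((-(1 / (m : ℝ)) : ℝ) : EReal) := by
      simp [critExponent, hm]
    have h2 : ((-(1 / (m : ℝ)) : ℝ) : EReal) ≠ 0 := by
      rw [← EReal.coe_zero, Ne, EReal.coe_eq_coe_iff]
      simpa using hm
    rw [h1, gammaMean, if_neg (EReal.coe_ne_bot _), if_neg (EReal.coe_ne_top _), if_neg h2,
      EReal.toReal_coe, hpq'] at h
    convert! h using 1
    push_cast
    congr 1
    field_simp

theorem sectionMeasure_eq_lintegral_indicator {n : ℕ} (φ : EuclideanSpace ℝ (Fin n) → ℝ≥0)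
    {A : Set (EuclideanSpace ℝ (Fin n))} (hA : MeasurableSet A) (u : EuclideanSpace ℝ (Fin n))
    (t : ℝ) : sectionMeasure φ A u t =
      ∫⁻ y : (ℝ ∙ u)ᗮ, A.indicator (fun x => (φ x : ℝ≥0∞)) (y + t • u) := by
  have : Measurable fun y : (ℝ ∙ u)ᗮ => (y : EuclideanSpace ℝ (Fin n)) + t • u := by fun_prop
  exact (lintegral_indicator (this hA) _).symm

/-- Linear concavity of the measure with density `φ` on sets with equal maximal sections orthogonal to
`u`, for positive weights. -/
theorem withDensity_smul_add_smul_ge {m : ℕ} {φ : EuclideanSpace ℝ (Fin (m + 1)) → ℝ≥0}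
    (hφ_meas : Measurable φ) (hφ : IsGammaConcave (critExponent (m + 1)) φ)
    {A B : Set (EuclideanSpace ℝ (Fin (m + 1)))} (hA : MeasurableSet A) (hB : MeasurableSet B)
    {u : EuclideanSpace ℝ (Fin (m + 1))} (hu : ‖u‖ = 1)
    (hAB : (⨆ t : ℝ, sectionMeasure φ A u t) = ⨆ t : ℝ, sectionMeasure φ B u t)
    {p q : ℝ≥0} (hp : p ≠ 0) (hq : q ≠ 0) (hpq : p + q = 1) :
    p * volume.withDensity (fun x => (φ x : ℝ≥0∞)) A +
      q * volume.withDensity (fun x => (φ x : ℝ≥0∞)) B ≤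
      volume.withDensity (fun x => (φ x : ℝ≥0∞)) ((p : ℝ) • A + (q : ℝ) • B) := by
  have hφ' : Measurable fun x => (φ x : ℝ≥0∞) := by fun_prop
  -- The Minkowski sum of Borel sets need not be Borel; a measurable hull of equal measure replaces
  -- it.
  rw [← measure_toMeasurable ((p : ℝ) • A + (q : ℝ) • B)]
  set C := toMeasurable (volume.withDensity fun x => (φ x : ℝ≥0∞)) ((p : ℝ) • A + (q : ℝ) • B)
    with hC_def
  have hsub : (p : ℝ) • A + (q : ℝ) • B ⊆ C := subset_toMeasurable _ _
  have hC : MeasurableSet C := measurableSet_toMeasurable _ _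
  have hmean : ∀ x y, recipMean m p q (A.indicator (fun x => (φ x : ℝ≥0∞)) x)
      (B.indicator (fun x => (φ x : ℝ≥0∞)) y) ≤
      C.indicator (fun x => (φ x : ℝ≥0∞)) ((p : ℝ) • x + (q : ℝ) • y) := by
    intro x y
    by_cases hx : x ∈ A
    · by_cases hy : y ∈ B
      · rw [indicator_of_mem hx, indicator_of_mem hy, indicator_of_mem
          (hsub (add_mem_add (smul_mem_smul_set hx) (smul_mem_smul_set hy)))]
        exact hφ.recipMean_le hp hq hpq x y
      · simp [indicator_of_notMem hy, recipMean.zero_right hq]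
    · simp [indicator_of_notMem hx, recipMean.zero_left hp]
  have hu0 : u ≠ 0 := by rintro rfl; simp at hu
  have hdim : Module.finrank ℝ (ℝ ∙ u)ᗮ = m := by
    have : Fact (Module.finrank ℝ (EuclideanSpace ℝ (Fin (m + 1))) = m + 1) := ⟨by simp⟩
    exact Submodule.finrank_orthogonal_span_singleton hu0
  have hfA := hφ'.indicator hA
  have hfB := hφ'.indicator hB
  have hfC := hφ'.indicator hC
  have hsections : ∀ s t : ℝ, min (sectionMeasure φ A u s) (sectionMeasure φ B u t) ≤
      sectionMeasure φ C u (p * s + q * t) := by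
    intro s t
    simp only [sectionMeasure_eq_lintegral_indicator φ, hA, hB, hC]
    -- The minimum is the case `k = 0`: on the `m`-dimensional sections, order `-1 / m` becomes
    -- `-∞`.
    rw [← recipMean.of_zero (p := p) (q := q)]
    refine recipMean_lintegral_le hp hq m hdim 0 (by fun_prop) (by fun_prop) (by fun_prop)
      fun x y => ?_
    refine (hmean _ _).trans_eq (congrArg _ ?_)
    push_cast
    module
  have hmeas : ∀ {D}, MeasurableSet D → Measurable (sectionMeasure φ D u) := fun {D} hD => by
    rw [funext (sectionMeasure_eq_lintegral_indicator φ hD u)]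
    exact measurable_lintegral_orthogonal u (hφ'.indicator hD)
  have hint : ∀ {D}, MeasurableSet D → volume.withDensity (fun x => (φ x : ℝ≥0∞)) D =
      ∫⁻ t, sectionMeasure φ D u t := fun {D} hD => by
    simp only [sectionMeasure_eq_lintegral_indicator φ hD]
    rw [withDensity_apply _ hD, ← lintegral_indicator hD,
      lintegral_eq_lintegral_lintegral_orthogonal hu (hφ'.indicator hD)]
  rw [hint hA, hint hB, hint hC]
  simpa using lintegral_add_le_of_min_le_of_iSup_eq (hmeas hA) (hmeas hB) (hmeas hC) (p := p)
    (q := q) (by positivity) (by positivity) hAB hsections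

theorem withDensity_eq_zero_of_sectionMeasure_eq_zero {n : ℕ}
    {φ : EuclideanSpace ℝ (Fin n) → ℝ≥0} (hφ_meas : Measurable φ)
    {A : Set (EuclideanSpace ℝ (Fin n))} (hA : MeasurableSet A) {u : EuclideanSpace ℝ (Fin n)}
    (hu : ‖u‖ = 1) (h : ∀ t, sectionMeasure φ A u t = 0) :
    volume.withDensity (fun x => (φ x : ℝ≥0∞)) A = 0 := by
  have hφ' : Measurable fun x => (φ x : ℝ≥0∞) := by fun_prop
  rw [withDensity_apply _ hA, ← lintegral_indicator hA,
    lintegral_eq_lintegral_lintegral_orthogonal hu (hφ'.indicator hA)]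
  simp [← sectionMeasure_eq_lintegral_indicator φ hA, h]

/-- This settles the endpoints of `[0, 1]`. The sum is empty when `B` is, but then equal suprema
force every section of `A` to be null, and so `A` itself. -/
theorem withDensity_le_one_smul_add_zero_smul {n : ℕ}
    {φ : EuclideanSpace ℝ (Fin n) → ℝ≥0} (hφ_meas : Measurable φ)
    {A B : Set (EuclideanSpace ℝ (Fin n))} (hA : MeasurableSet A) {u : EuclideanSpace ℝ (Fin n)}
    (hu : ‖u‖ = 1)
    (hAB : (⨆ t : ℝ, sectionMeasure φ A u t) = ⨆ t : ℝ, sectionMeasure φ B u t) :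
    volume.withDensity (fun x => (φ x : ℝ≥0∞)) A ≤
      volume.withDensity (fun x => (φ x : ℝ≥0∞)) ((1 : ℝ) • A + (0 : ℝ) • B) := by
  rcases B.eq_empty_or_nonempty with rfl | hB
  · rw [withDensity_eq_zero_of_sectionMeasure_eq_zero hφ_meas hA hu]
    · exact zero_le
    · simpa [sectionMeasure] using hAB
  · rw [zero_smul_set hB, one_smul, add_zero]

theorem mainTheorem4 (n : ℕ) (hn : 1 ≤ n)
    (φ : EuclideanSpace ℝ (Fin n) → ℝ≥0) (hφ_meas : Measurable φ)
    (hφ : IsGammaConcave (critExponent n) φ)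
    (μ : Measure (EuclideanSpace ℝ (Fin n)))
    (hμ : μ = (volume : Measure (EuclideanSpace ℝ (Fin n))).withDensity (fun x => (φ x : ℝ≥0∞)))
    (A B : Set (EuclideanSpace ℝ (Fin n))) (hA : MeasurableSet A) (hB : MeasurableSet B)
    (hAB : ∃ u : EuclideanSpace ℝ (Fin n), ‖u‖ = 1 ∧
      (⨆ t : ℝ, sectionMeasure φ A u t) = ⨆ t : ℝ, sectionMeasure φ B u t) :
    ∀ lam ∈ Icc (0 : ℝ) 1,
      ENNReal.ofReal (1 - lam) * μ A + ENNReal.ofReal lam * μ B ≤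
        μ ((1 - lam) • A + lam • B) := by
  rintro lam ⟨h0, h1⟩
  obtain ⟨u, hu, hAB⟩ := hAB
  obtain ⟨m, rfl⟩ : ∃ m, n = m + 1 := ⟨n - 1, by omega⟩
  subst hμ
  rcases h0.eq_or_lt with rfl | h0
  · simpa using withDensity_le_one_smul_add_zero_smul hφ_meas hA hu hAB
  rcases h1.eq_or_lt with rfl | h1
  · simpa [add_comm] using withDensity_le_one_smul_add_zero_smul hφ_meas hB hu hAB.symm
  · lift lam to ℝ≥0 using h0.le
    obtain ⟨p, hp⟩ : ∃ p : ℝ≥0, (p : ℝ) = 1 - lam := ⟨⟨1 - lam, by linarith⟩, rfl⟩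
    rw [← hp, ENNReal.ofReal_coe_nnreal, ENNReal.ofReal_coe_nnreal]
    refine withDensity_smul_add_smul_ge hφ_meas hφ hA hB hu hAB ?_ ?_ ?_
    · rintro rfl
      simp only [NNReal.coe_zero] at hp
      linarith
    · rintro rfl
      simp at h0
    · rw [← NNReal.coe_inj]
      push_cast
      linarith
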